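/- Let $1\le p<\infty$ and $\alpha,m>0$. Let $\mathcal F^p_{(\alpha,m)}$ be the space of all entire functions $f:\mathbb C\to\mathbb C$ with $$\|f\|_{(p,\alpha,m)}^p=\int_{\mathbb C}|f(z)|^p e^{-p\alpha|z|^m}\,dA(z)<\infty ,$$ where $dA$ is Lebesgue area measure on $\mathbb C$, normed by $\|\cdot\|_{(p,\alpha,m)}$. Suppose that the differentiation operator $Df=f'$ is bounded on $\mathcal F^p_{(\alpha,m)}$, that is, $D$ maps $\mathcal F^p_{(\alpha,m)}$ into itself and is continuous for its norm. Then $m\le 1$, and the following hold. (i) $D$ is hypercyclic on $\mathcal F^p_{(\alpha,m)}$ (there is $f\in\mathcal F^p_{(\alpha,m)}$ whose orbit $\{D^nf: n\ge 0\}$ is dense in $\mathcal F^p_{(\alpha,m)}$) if and only if either $m=1$ and $\alpha>1$, or $m=1$, $\alpha=1$ and $p>3$. (ii) $D$ is supercyclic on $\mathcal F^p_{(\alpha,m)}$ (there is $f\in\mathcal F^p_{(\alpha,m)}$ whose projective orbit $\{\lambda D^nf:\lambda\in\mathbb C,\ n\ge 0\}$ is dense), and hence cyclic (there is $f\in\mathcal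 F^p_{(\alpha,m)}$ such that the linear span of $\{D^nf:n\ge 0\}$ is dense). -/

import Mathlib

open MeasureTheory

noncomputable section

/-- The integrand `|f(z)|^p e^{-p α |z|^m}` of the norm of the generalized Fock space. -/
def fockIntegrand (p α m : ℝ) (f : ℂ → ℂ) (z : ℂ) : ℝ :=
  ‖f z‖ ^ p * Real.exp (-(p * α * ‖z‖ ^ m))

/-- The function `f(z) e^{-α |z|^m}`, used only to verify the vector space and norm axioms. -/
def fockWeighted (α m : ℝ) (f : ℂ → ℂ) (z : ℂ) : ℂ :=
  (Real.exp (-(α * ‖z‖ ^ m)) : ℂ) * f z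

theorem measurable_fockWeight (α m : ℝ) :
    Measurable (fun z : ℂ => (Real.exp (-(α * ‖z‖ ^ m)) : ℂ)) := by
  fun_prop

theorem aestronglyMeasurable_fockWeighted (α m : ℝ) {f : ℂ → ℂ} (hf : Continuous f) :
    AEStronglyMeasurable (fockWeighted α m f) volume :=
  ((measurable_fockWeight α m).mul hf.measurable).aestronglyMeasurable

theorem fockIntegrand_eq (p α m : ℝ) (f : ℂ → ℂ) (z : ℂ) :
    fockIntegrand p α m f z = ‖fockWeighted α m f z‖ ^ p := by
  unfold fockIntegrand fockWeighted
  rw [norm_mul, Complex.norm_real, Real.norm_eq_abs, Real.abs_exp,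
    Real.mul_rpow (Real.exp_pos _).le (norm_nonneg _), ← Real.exp_mul, mul_comm]
  congr 2
  ring

theorem integrable_fockIntegrand_iff {p : ℝ} (hp : 1 ≤ p) (α m : ℝ) {f : ℂ → ℂ}
    (hf : Continuous f) :
    Integrable (fockIntegrand p α m f) volume ↔
      MemLp (fockWeighted α m f) (ENNReal.ofReal p) volume := by
  have h0 : ENNReal.ofReal p ≠ 0 := by
    simp only [ne_eq, ENNReal.ofReal_eq_zero, not_le]; linarith
  rw [← integrable_norm_rpow_iff (aestronglyMeasurable_fockWeighted α m hf) h0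
    ENNReal.ofReal_ne_top, ENNReal.toReal_ofReal (by linarith)]
  exact integrable_congr (Filter.Eventually.of_forall fun z => fockIntegrand_eq p α m f z)

theorem fockIntegral_rpow_eq {p : ℝ} (hp : 1 ≤ p) (α m : ℝ) {f : ℂ → ℂ}
    (hf : Continuous f) (hi : Integrable (fockIntegrand p α m f) volume) :
    (∫ z, fockIntegrand p α m f z) ^ (1 / p) =
      (eLpNorm (fockWeighted α m f) (ENNReal.ofReal p) volume).toReal := by
  have h0 : ENNReal.ofReal p ≠ 0 := by
    simp only [ne_eq, ENNReal.ofReal_eq_zero, not_le]; linarith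
  have hpp : (ENNReal.ofReal p).toReal = p := ENNReal.toReal_ofReal (by linarith)
  rw [((integrable_fockIntegrand_iff hp α m hf).1 hi).eLpNorm_eq_integral_rpow_norm h0
    ENNReal.ofReal_ne_top, hpp, ENNReal.toReal_ofReal (by positivity), one_div]
  simp only [fockIntegrand_eq]

theorem fockWeighted_add (α m : ℝ) (f g : ℂ → ℂ) :
    fockWeighted α m (f + g) = fockWeighted α m f + fockWeighted α m g := by
  funext z; simp only [fockWeighted, Pi.add_apply]; ring

theorem fockWeighted_smul (α m : ℝ) (c : ℂ) (f : ℂ → ℂ) :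
    fockWeighted α m (c • f) = c • fockWeighted α m f := by
  funext z; simp only [fockWeighted, Pi.smul_apply, smul_eq_mul]; ring

/-- The entire functions `f` with `∫ |f(z)|^p e^{-p α |z|^m} dA(z) < ∞`, `dA` being Lebesgue
area measure on `ℂ`, as a vector space. The class `Fact (1 ≤ p)` carries the hypothesis on `p`. -/
def fockSubmodule (p α m : ℝ) [hp : Fact (1 ≤ p)] : Submodule ℂ (ℂ → ℂ) where
  carrier := {f | Differentiable ℂ f ∧ Integrable (fockIntegrand p α m f) volume}
  add_mem' := by
    rintro f g ⟨hf, hfi⟩ ⟨hg, hgi⟩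
    refine ⟨hf.add hg, ?_⟩
    rw [integrable_fockIntegrand_iff hp.out α m (hf.continuous.add hg.continuous),
      fockWeighted_add]
    exact ((integrable_fockIntegrand_iff hp.out α m hf.continuous).1 hfi).add
      ((integrable_fockIntegrand_iff hp.out α m hg.continuous).1 hgi)
  zero_mem' := by
    have hp0 : p ≠ 0 := by have := hp.out; linarith
    refine ⟨differentiable_const 0, ?_⟩
    have : fockIntegrand p α m 0 = 0 := by
      funext z; simp [fockIntegrand, Real.zero_rpow hp0]
    rw [this]
    exact integrable_zero _ _ _
  smul_mem' := by
    rintro c f ⟨hf, hfi⟩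
    refine ⟨hf.const_smul c, ?_⟩
    rw [integrable_fockIntegrand_iff hp.out α m (hf.continuous.const_smul c),
      fockWeighted_smul]
    exact ((integrable_fockIntegrand_iff hp.out α m hf.continuous).1 hfi).const_smul c

/-- The generalized Fock space `F^p_{(α,m)}`. It is a type of its own, so that its topology is
the one of the norm below and not that of pointwise convergence. -/
def FockSpace (p α m : ℝ) [Fact (1 ≤ p)] : Type := ↥(fockSubmodule p α m)

namespace FockSpace

variable {p α m : ℝ} [hp : Fact (1 ≤ p)]

instance : AddCommGroup (FockSpace p α m) :=
  inferInstanceAs (AddCommGroup ↥(fockSubmodule p α m))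

instance : Module ℂ (FockSpace p α m) :=
  inferInstanceAs (Module ℂ ↥(fockSubmodule p α m))

instance : CoeFun (FockSpace p α m) (fun _ => ℂ → ℂ) := ⟨fun f => f.1⟩

/-- The norm `(∫ |f(z)|^p e^{-p α |z|^m} dA(z))^{1/p}`. -/
instance : Norm (FockSpace p α m) :=
  ⟨fun f => (∫ z, fockIntegrand p α m f z) ^ (1 / p)⟩

theorem norm_def (f : FockSpace p α m) :
    ‖f‖ = (∫ z, ‖f z‖ ^ p * Real.exp (-(p * α * ‖z‖ ^ m))) ^ (1 / p) := rfl

theorem memLp (f : FockSpace p α m) :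
    MemLp (fockWeighted α m f) (ENNReal.ofReal p) volume :=
  (integrable_fockIntegrand_iff hp.out α m f.2.1.continuous).1 f.2.2

theorem norm_eq (f : FockSpace p α m) :
    ‖f‖ = (eLpNorm (fockWeighted α m f) (ENNReal.ofReal p) volume).toReal :=
  fockIntegral_rpow_eq hp.out α m f.2.1.continuous f.2.2

theorem normCore : NormedSpace.Core ℂ (FockSpace p α m) where
  norm_nonneg f := by rw [norm_eq]; exact ENNReal.toReal_nonneg
  norm_smul c f := by
    have : fockWeighted α m (c • f : FockSpace p α m) = c • fockWeighted α m f :=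
      fockWeighted_smul α m c f
    rw [norm_eq, norm_eq, this, eLpNorm_const_smul, ENNReal.toReal_mul, toReal_enorm]
  norm_triangle f g := by
    have h : fockWeighted α m (f + g : FockSpace p α m) =
        fockWeighted α m f + fockWeighted α m g := fockWeighted_add α m f g
    have h1 : 1 ≤ ENNReal.ofReal p := by
      rw [← ENNReal.ofReal_one]; exact ENNReal.ofReal_le_ofReal hp.out
    rw [norm_eq, norm_eq, norm_eq, h, ← ENNReal.toReal_add f.memLp.2.ne g.memLp.2.ne]
    exact ENNReal.toReal_mono (ENNReal.add_ne_top.2 ⟨f.memLp.2.ne, g.memLp.2.ne⟩)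
      (eLpNorm_add_le f.memLp.1 g.memLp.1 h1)
  norm_eq_zero_iff f := by
    have h0 : ENNReal.ofReal p ≠ 0 := by
      have := hp.out
      simp only [ne_eq, ENNReal.ofReal_eq_zero, not_le]; linarith
    rw [norm_eq, ENNReal.toReal_eq_zero_iff, or_iff_left f.memLp.2.ne,
      eLpNorm_eq_zero_iff f.memLp.1 h0]
    constructor
    · intro h
      have h2 : (f.1 : ℂ → ℂ) =ᵐ[volume] (0 : ℂ → ℂ) := by
        filter_upwards [h] with z hz
        simpa [fockWeighted] using hz
      have h3 : f.1 = 0 :=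
        (Continuous.ae_eq_iff_eq volume f.2.1.continuous continuous_zero).1 h2
      exact Subtype.ext h3
    · rintro rfl
      refine Filter.Eventually.of_forall fun z => ?_
      change _ * (0 : ℂ) = 0
      exact mul_zero _

instance : NormedAddCommGroup (FockSpace p α m) := NormedAddCommGroup.ofCore normCore

instance : NormedSpace ℂ (FockSpace p α m) := NormedSpace.ofCore normCore

end FockSpace

section Cyclicity

variable {X : Type*} [NormedAddCommGroup X] [NormedSpace ℂ X]

/-- Some orbit `{Tⁿ x : n ≥ 0}` is dense. -/
def IsHypercyclic (T : X →L[ℂ] X) : Prop :=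
  ∃ x : X, Dense {y : X | ∃ n : ℕ, y = (T ^ n) x}

/-- Some projective orbit `{λ Tⁿ x : n ≥ 0, λ ∈ ℂ}` is dense. -/
def IsSupercyclic (T : X →L[ℂ] X) : Prop :=
  ∃ x : X, Dense {y : X | ∃ (c : ℂ) (n : ℕ), y = c • (T ^ n) x}

/-- The linear span of some orbit is dense. -/
def IsCyclicOperator (T : X →L[ℂ] X) : Prop :=
  ∃ x : X, Dense (Submodule.span ℂ {y : X | ∃ n : ℕ, y = (T ^ n) x} : Set X)

end Cyclicity

end

noncomputable section

open Filter Topology Asymptotics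

/-! On the monomials `e n = z ^ n / n!` differentiation is a backward shift: it kills `e 0` and
sends `e (n + 1)` to `e n`. The dynamics are governed by the numbers `‖e n‖`, through two facts. The
span of the `e n` is dense (`dense_span_monomial`), and `|f⁽ⁿ⁾(0)| * ‖e n‖ ≤ ‖f‖` for every `f`
(`norm_iteratedDeriv_mul_norm_monomial_le`, by averaging over rotations).

If `‖e n‖ → 0`, the vectors `e (k + n)` are small preimages of `e k` under `D ^ n`, and Birkhoff's
transitivity theorem in the complete space gives a dense orbit. If `‖e n‖` is bounded below, `n ↦ (D
^ n f)(0)` is bounded for each `f`, so no orbit is dense. For supercyclicity the scalar makes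
preimages as small as needed, so no decay is required. Boundedness of `D` gives `‖e 0‖ ≤ ‖D‖ ^ n *
‖e n‖`, so `‖e n‖` cannot decay superexponentially.

Polar coordinates turn `‖e n‖` into a Gamma value, and Stirling gives `log ‖e n‖ = A n log n + B n +
E log n + O(1)` with `A = 1/m - 1` (`exists_abs_log_norm_monomial_sub_le`). Hence `m ≤ 1`; for `m <
1` the norms tend to infinity. For `m = 1` one finds `A = 0`, `B = -log α`, `E = (3 - p)/(2p)`,
whose signs decide hypercyclicity. -/

/-! ### Stirling estimates for factorials and the Gamma function -/

theorem exists_abs_log_factorial_sub_le :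
    ∃ K : ℝ, ∀ n : ℕ, 1 ≤ n →
      |Real.log (n.factorial : ℝ) - ((n + 1 / 2) * Real.log n - n)| ≤ K := by
  -- The first two terms are the lower and upper bounds for `log (stirlingSeq n)`; the last accounts
  -- for the factor `√(2n)`, rather than `√n`, in the normalisation of `stirlingSeq`.
  refine ⟨|1 - 12⁻¹ - Real.log 2 / 2| + |Real.log (Stirling.stirlingSeq 1)| +
    1 / 2 * Real.log 2, fun n hn => ?_⟩
  have hn0 : (n : ℝ) ≠ 0 := by positivity
  obtain ⟨k, rfl⟩ : ∃ k, n = k + 1 := ⟨n - 1, by omega⟩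
  have h1 := Stirling.log_stirlingSeq_formula (k + 1)
  have h2 := Stirling.log_stirlingSeq_bounded_by_constant k
  have h3 : Real.log (Stirling.stirlingSeq (k + 1)) ≤ Real.log (Stirling.stirlingSeq 1) :=
    Stirling.log_stirlingSeq'_antitone (Nat.zero_le k)
  rw [Real.log_mul two_ne_zero hn0, Real.log_div hn0 (Real.exp_pos _).ne', Real.log_exp] at h1
  have h4 : 0 ≤ Real.log 2 := Real.log_nonneg one_le_two
  have := neg_abs_le (1 - 12⁻¹ - Real.log 2 / 2)
  have := le_abs_self (Real.log (Stirling.stirlingSeq 1))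
  have := abs_nonneg (1 - 12⁻¹ - Real.log 2 / 2)
  have := abs_nonneg (Real.log (Stirling.stirlingSeq 1))
  rw [abs_le]
  constructor <;> nlinarith

/-- Convexity of `log Γ` on `[x, x + 1]`, with the functional equation at the right endpoint. -/
theorem log_Gamma_add_le {x s : ℝ} (hx : 0 < x) (hs : 0 ≤ s) (hs1 : s ≤ 1) :
    Real.log (Real.Gamma (x + s)) ≤ Real.log (Real.Gamma x) + s * Real.log x := by
  have h := Real.convexOn_log_Gamma.2 (Set.mem_Ioi.2 hx) (Set.mem_Ioi.2 (by linarith : 0 < x + 1))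
    (sub_nonneg.2 hs1) hs (by ring)
  simp only [Function.comp, smul_eq_mul, Real.Gamma_add_one hx.ne'] at h
  rw [Real.log_mul hx.ne' (Real.Gamma_pos_of_pos hx).ne'] at h
  have e : (1 - s) * x + s * (x + 1) = x + s := by ring
  rw [e] at h
  linarith

/-- A weak form of Stirling's formula for the Gamma function. -/
theorem exists_abs_log_Gamma_sub_le :
    ∃ K : ℝ, ∀ x : ℝ, 1 ≤ x →
      |Real.log (Real.Gamma x) - ((x - 1 / 2) * Real.log x - x)| ≤ K := by
  obtain ⟨K, hK⟩ := exists_abs_log_factorial_sub_le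
  refine ⟨K + 2, fun x hx => ?_⟩
  have hx0 : 0 < x := by linarith
  set N := ⌊x⌋₊ with hN
  have hN1 : 1 ≤ N := Nat.le_floor (by simpa using hx)
  have hNx : (N : ℝ) ≤ x := Nat.floor_le hx0.le
  have hxN : x < N + 1 := Nat.lt_floor_add_one x
  have hN1' : (1 : ℝ) ≤ N := by exact_mod_cast hN1
  have hN0 : (0 : ℝ) < N := by linarith
  have hk := abs_le.1 (hK N hN1)
  have hfac : Real.log (N.factorial : ℝ) = Real.log (Real.Gamma (N + 1)) := by
    rw [Real.Gamma_nat_eq_factorial]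
  have hrec : Real.log (Real.Gamma (N + 1)) = Real.log N + Real.log (Real.Gamma N) := by
    rw [Real.Gamma_add_one hN0.ne', Real.log_mul hN0.ne' (Real.Gamma_pos_of_pos hN0).ne']
  -- Moving from `N` up to `x`, and from `x` up to `N + 1`, encloses `log Γ(x)` between two
  -- expressions in `log N!`.
  have hup := log_Gamma_add_le hN0 (s := x - N) (by linarith) (by linarith)
  have hlo := log_Gamma_add_le hx0 (s := N + 1 - x) (by linarith) (by linarith)
  rw [add_sub_cancel] at hup hlo
  have hd0 : Real.log N ≤ Real.log x := Real.log_le_log hN0 hNx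
  have hd1 : Real.log x - Real.log N ≤ 1 / N := by
    rw [← Real.log_div hx0.ne' hN0.ne']
    refine (Real.log_le_sub_one_of_pos (by positivity)).trans ?_
    rw [div_sub_one hN0.ne']
    gcongr
    linarith
  have hd2 : N * (Real.log x - Real.log N) ≤ 1 := by
    calc _ ≤ (N : ℝ) * (1 / N) := by gcongr
      _ = 1 := by field_simp
  have hd3 : Real.log x - Real.log N ≤ 1 := hd1.trans (by
    rw [div_le_one hN0]; exact hN1')
  rw [abs_le]
  constructor
  · nlinarith
  · have : (x - 1 / 2) * Real.log N ≤ (x - 1 / 2) * Real.log x :=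
      mul_le_mul_of_nonneg_left hd0 (by linarith)
    nlinarith

/-- Write `log (a n + b) = log n + log a + ε`. Since `0 ≤ ε ≤ b / (a n)`, even the product `a n ε`
is bounded, so only the displayed terms survive. -/
theorem log_Gamma_affine_isBigO {a b : ℝ} (ha : 0 < a) (hb : 0 < b) :
    (fun n : ℕ => Real.log (Real.Gamma (a * n + b)) -
      (a * (n * Real.log n) + (a * Real.log a - a) * n + (b - 1 / 2) * Real.log n))
      =O[atTop] (fun _ => (1 : ℝ)) := by
  obtain ⟨K, hK⟩ := exists_abs_log_Gamma_sub_le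
  refine IsBigO.of_bound (K + (|(b - 1 / 2) * Real.log a - b| + (b + (b + 1 / 2) * (b / a)))) ?_
  have hx1 : ∀ᶠ n : ℕ in atTop, 1 ≤ a * n + b := by
    have : Tendsto (fun n : ℕ => a * (n : ℝ) + b) atTop atTop :=
      tendsto_atTop_add_const_right _ _
        (tendsto_natCast_atTop_atTop.const_mul_atTop ha)
    exact this.eventually_ge_atTop 1
  filter_upwards [hx1, eventually_ge_atTop 1] with n hn1 hn
  have hn' : (1 : ℝ) ≤ n := by exact_mod_cast hn
  have hn0 : (0 : ℝ) < n := by linarith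
  have han : 0 < a * n := by positivity
  have h := hK _ hn1
  set ε := Real.log (1 + b / (a * n)) with hε
  have hlog : Real.log (a * n + b) = Real.log n + Real.log a + ε := by
    rw [hε, add_comm (Real.log n), ← Real.log_mul ha.ne' hn0.ne',
      ← Real.log_mul han.ne' (by positivity)]
    congr 1
    field_simp
  have hε0 : 0 ≤ ε := Real.log_nonneg (by
    have : 0 ≤ b / (a * n) := by positivity
    linarith)
  have hε1 : ε ≤ b / (a * n) := by
    have := Real.log_le_sub_one_of_pos (x := 1 + b / (a * n)) (by positivity)
    linarith
  have hε2 : a * n * ε ≤ b := by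
    calc _ ≤ a * n * (b / (a * n)) := by gcongr
      _ = b := by field_simp
  have hε3 : ε ≤ b / a := hε1.trans (by
    gcongr
    nlinarith)
  have hε4 : (b + 1 / 2) * ε ≤ (b + 1 / 2) * (b / a) := by gcongr
  rw [hlog] at h
  simp only [norm_one, mul_one, Real.norm_eq_abs]
  have hl := neg_abs_le ((b - 1 / 2) * Real.log a - b)
  have hr := le_abs_self ((b - 1 / 2) * Real.log a - b)
  have hp : 0 ≤ a * n * ε := by positivity
  have hbε : 0 ≤ b * ε := by positivity
  rw [abs_le] at h ⊢
  constructor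
  · nlinarith
  · nlinarith

theorem log_factorial_isBigO :
    (fun n : ℕ => Real.log (n.factorial : ℝ) - (n * Real.log n - n + 1 / 2 * Real.log n))
      =O[atTop] (fun _ => (1 : ℝ)) := by
  obtain ⟨K, hK⟩ := exists_abs_log_factorial_sub_le
  refine IsBigO.of_bound K ?_
  filter_upwards [eventually_ge_atTop 1] with n hn
  have := hK n hn
  simp only [norm_one, mul_one, Real.norm_eq_abs]
  convert this using 2
  ring

/-! ### Criteria for hypercyclicity and supercyclicity; backward shifts -/

/-- Birkhoff's transitivity theorem for a family of continuous self-maps. -/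
theorem exists_dense_range_of_transitive {X ι : Type*} [TopologicalSpace X] [BaireSpace X]
    [SecondCountableTopology X] [Nonempty X] (F : ι → X → X) (hF : ∀ i, Continuous (F i))
    (h : ∀ U V : Set X, IsOpen U → IsOpen V → U.Nonempty → V.Nonempty →
      ∃ i, ∃ x ∈ U, F i x ∈ V) :
    ∃ x, Dense (Set.range fun i => F i x) := by
  have hb := TopologicalSpace.isBasis_countableBasis X
  -- This is the set of points whose orbit meets every basic open set; Baire's theorem makes it
  -- dense.
  have hd : Dense (⋂ V ∈ TopologicalSpace.countableBasis X, ⋃ i, F i ⁻¹' V) := by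
    refine dense_biInter_of_isOpen (fun V hV => isOpen_iUnion fun i =>
      (hb.isOpen hV).preimage (hF i)) (TopologicalSpace.countable_countableBasis X) ?_
    intro V hV
    rw [dense_iff_inter_open]
    intro U hU hUne
    obtain ⟨i, x, hx, hxV⟩ := h U V hU (hb.isOpen hV) hUne
      (TopologicalSpace.nonempty_of_mem_countableBasis hV)
    exact ⟨x, hx, Set.mem_iUnion.2 ⟨i, hxV⟩⟩
  obtain ⟨x, hx⟩ := hd.nonempty
  refine ⟨x, hb.dense_iff.2 fun V hV _ => ?_⟩
  obtain ⟨i, hi⟩ := Set.mem_iUnion.1 (Set.mem_iInter₂.1 hx V hV)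
  exact ⟨F i x, hi, i, rfl⟩

section Criteria

variable {X : Type*} [NormedAddCommGroup X] [NormedSpace ℂ X]

/-- For `u ∈ U` and `v ∈ V` in `Y`, the point `u + w n` lies in `U` for large `n`, while `T ^ n`
kills `u` and sends it to `v`. -/
theorem isHypercyclic_of_criterion [CompleteSpace X] [SecondCountableTopology X]
    {T : X →L[ℂ] X} {Y : Set X} (hY : Dense Y)
    (h0 : ∀ u ∈ Y, ∀ᶠ n in atTop, (T ^ n) u = 0)
    (h1 : ∀ v ∈ Y, ∃ w : ℕ → X, (∀ n, (T ^ n) (w n) = v) ∧ Tendsto w atTop (𝓝 0)) :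
    IsHypercyclic T := by
  obtain ⟨x, hx⟩ := exists_dense_range_of_transitive (fun (n : ℕ) (x : X) => (T ^ n) x)
    (fun n => (T ^ n).continuous) (by
      intro U V hU hV hUne hVne
      obtain ⟨u, huU, huY⟩ := hY.inter_open_nonempty U hU hUne
      obtain ⟨v, hvV, hvY⟩ := hY.inter_open_nonempty V hV hVne
      obtain ⟨w, hw, hw0⟩ := h1 v hvY
      have hlim : Tendsto (fun n => u + w n) atTop (𝓝 u) := by
        simpa using tendsto_const_nhds.add hw0
      obtain ⟨n, hn, hnU⟩ := ((h0 u huY).and (hlim.eventually (hU.mem_nhds huU))).exists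
      refine ⟨n, u + w n, hnU, ?_⟩
      rw [map_add, hn, hw, zero_add]
      exact hvV)
  refine ⟨x, ?_⟩
  convert hx using 1
  ext y
  simp [eq_comm]

/-- The preimage `w` need not be small: `u + c • w` is near `u` for small `c ≠ 0`, and `c⁻¹ • T ^ n`
sends it to `v`. -/
theorem isSupercyclic_of_criterion [CompleteSpace X] [SecondCountableTopology X]
    {T : X →L[ℂ] X} {Y : Set X} (hY : Dense Y)
    (h0 : ∀ u ∈ Y, ∀ᶠ n in atTop, (T ^ n) u = 0)
    (h1 : ∀ v ∈ Y, ∀ n, ∃ w, (T ^ n) w = v) :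
    IsSupercyclic T := by
  obtain ⟨x, hx⟩ := exists_dense_range_of_transitive
    (fun (i : ℂ × ℕ) (x : X) => i.1 • (T ^ i.2) x)
    (fun i => (T ^ i.2).continuous.const_smul i.1) (by
      intro U V hU hV hUne hVne
      obtain ⟨u, huU, huY⟩ := hY.inter_open_nonempty U hU hUne
      obtain ⟨v, hvV, hvY⟩ := hY.inter_open_nonempty V hV hVne
      obtain ⟨n, hn⟩ := (h0 u huY).exists
      obtain ⟨w, hw⟩ := h1 v hvY n
      have hlim : Tendsto (fun c : ℂ => u + c • w) (𝓝[≠] 0) (𝓝 u) := by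
        have : Tendsto (fun c : ℂ => u + c • w) (𝓝 0) (𝓝 (u + (0 : ℂ) • w)) :=
          (by fun_prop : Continuous fun c : ℂ => u + c • w).tendsto 0
        simpa using this.mono_left nhdsWithin_le_nhds
      obtain ⟨c, hcU, hc⟩ := ((hlim.eventually (hU.mem_nhds huU)).and
        self_mem_nhdsWithin).exists
      refine ⟨(c⁻¹, n), u + c • w, hcU, ?_⟩
      simp only [map_add, map_smul, hn, hw, zero_add, smul_smul, inv_mul_cancel₀ hc, one_smul]
      exact hvV)
  refine ⟨x, ?_⟩
  convert hx using 1
  ext y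
  simp [eq_comm]

theorem IsSupercyclic.isCyclicOperator {T : X →L[ℂ] X} (hT : IsSupercyclic T) :
    IsCyclicOperator T := by
  obtain ⟨x, hx⟩ := hT
  refine ⟨x, hx.mono ?_⟩
  rintro _ ⟨c, n, rfl⟩
  exact Submodule.smul_mem _ _ (Submodule.subset_span ⟨n, rfl⟩)

variable {T : X →L[ℂ] X} {e : ℕ → X}

theorem pow_apply_of_backward_shift (hs : ∀ n, T (e (n + 1)) = e n) (k n : ℕ) :
    (T ^ n) (e (k + n)) = e k := by
  induction n with
  | zero => simp
  | succ n ih => rw [pow_succ, mul_apply_eq_comp, ← add_assoc, hs, ih]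

theorem eventually_pow_eq_zero_of_backward_shift (hz : T (e 0) = 0)
    (hs : ∀ n, T (e (n + 1)) = e n) {u : X} (hu : u ∈ Submodule.span ℂ (Set.range e)) :
    ∀ᶠ n in atTop, (T ^ n) u = 0 := by
  induction hu using Submodule.span_induction with
  | mem x hx =>
    obtain ⟨k, rfl⟩ := hx
    filter_upwards [eventually_ge_atTop (k + 1)] with n hn
    obtain ⟨j, rfl⟩ := Nat.exists_eq_add_of_le' hn
    have := pow_apply_of_backward_shift hs 0 k
    rw [zero_add] at this
    rw [pow_add, pow_succ', mul_apply_eq_comp, mul_apply_eq_comp, this,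
      hz, map_zero]
  | zero => simp
  | add x y _ _ hx hy =>
    filter_upwards [hx, hy] with n h1 h2
    rw [map_add, h1, h2, add_zero]
  | smul c x _ hx =>
    filter_upwards [hx] with n h1
    rw [map_smul, h1, smul_zero]

theorem secondCountableTopology_of_dense_span
    (hd : Dense (Submodule.span ℂ (Set.range e) : Set X)) : SecondCountableTopology X := by
  have h1 : TopologicalSpace.IsSeparable (Submodule.span ℂ (Set.range e) : Set X) :=
    (Set.countable_range e).isSeparable.span
  have h2 : TopologicalSpace.IsSeparable (Set.univ : Set X) := hd.closure_eq ▸ h1.closure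
  have : TopologicalSpace.SeparableSpace X := TopologicalSpace.isSeparable_univ_iff.1 h2
  exact UniformSpace.secondCountable_of_separable X

theorem isSupercyclic_of_backward_shift [CompleteSpace X] (hz : T (e 0) = 0)
    (hs : ∀ n, T (e (n + 1)) = e n) (hd : Dense (Submodule.span ℂ (Set.range e) : Set X)) :
    IsSupercyclic T := by
  have := secondCountableTopology_of_dense_span hd
  refine isSupercyclic_of_criterion hd
    (fun u hu => eventually_pow_eq_zero_of_backward_shift hz hs hu) fun v hv n => ?_
  induction hv using Submodule.span_induction with
  | mem x hx =>
    obtain ⟨k, rfl⟩ := hx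
    exact ⟨_, pow_apply_of_backward_shift hs k n⟩
  | zero => exact ⟨0, map_zero _⟩
  | add x y _ _ hx hy =>
    obtain ⟨a, rfl⟩ := hx
    obtain ⟨b, rfl⟩ := hy
    exact ⟨a + b, map_add _ _ _⟩
  | smul c x _ hx =>
    obtain ⟨a, rfl⟩ := hx
    exact ⟨c • a, map_smul _ _ _⟩

theorem isHypercyclic_of_backward_shift [CompleteSpace X] (hz : T (e 0) = 0)
    (hs : ∀ n, T (e (n + 1)) = e n) (hd : Dense (Submodule.span ℂ (Set.range e) : Set X))
    (he : Tendsto e atTop (𝓝 0)) : IsHypercyclic T := by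
  have := secondCountableTopology_of_dense_span hd
  refine isHypercyclic_of_criterion hd
    (fun u hu => eventually_pow_eq_zero_of_backward_shift hz hs hu) fun v hv => ?_
  induction hv using Submodule.span_induction with
  | mem x hx =>
    obtain ⟨k, rfl⟩ := hx
    refine ⟨fun n => e (k + n), pow_apply_of_backward_shift hs k, ?_⟩
    exact he.comp (tendsto_atTop_mono (fun n => Nat.le_add_left n k) tendsto_id)
  | zero => exact ⟨0, fun n => map_zero _, tendsto_const_nhds⟩
  | add x y _ _ hx hy =>
    obtain ⟨a, ha, ha0⟩ := hx
    obtain ⟨b, hb, hb0⟩ := hy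
    exact ⟨fun n => a n + b n, fun n => by rw [map_add, ha, hb],
      by simpa using ha0.add hb0⟩
  | smul c x _ hx =>
    obtain ⟨a, ha, ha0⟩ := hx
    exact ⟨fun n => c • a n, fun n => by rw [map_smul, ha],
      by simpa using ha0.const_smul c⟩

/-- An operator whose orbits stay bounded under some nonzero continuous functional is not
hypercyclic. -/
theorem not_isHypercyclic_of_bounded_functional (φ : X →L[ℂ] ℂ) (hφ : φ ≠ 0)
    (hb : ∀ x, ∃ C : ℝ, ∀ n, ‖φ ((T ^ n) x)‖ ≤ C) : ¬ IsHypercyclic T := by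
  rintro ⟨x, hx⟩
  obtain ⟨C, hC⟩ := hb x
  have hclosed : IsClosed {y : X | ‖φ y‖ ≤ C} := isClosed_le (by fun_prop) continuous_const
  have hall : ∀ y, ‖φ y‖ ≤ C := by
    intro y
    have hsub : {y : X | ∃ n : ℕ, y = (T ^ n) x} ⊆ {y : X | ‖φ y‖ ≤ C} := by
      rintro _ ⟨n, rfl⟩
      exact hC n
    exact closure_minimal hsub hclosed (hx y)
  obtain ⟨y, hy⟩ : ∃ y, φ y ≠ 0 := by
    by_contra! h
    exact hφ (ContinuousLinearMap.ext h)
  -- This multiple of `y` has `‖φ ·‖ = C + 1`, beyond the supposed bound.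
  have h := hall ((((C + 1) / ‖φ y‖ : ℝ) : ℂ) • y)
  have hC0 : 0 ≤ C := (norm_nonneg _).trans (hall y)
  rw [map_smul, smul_eq_mul, norm_mul, Complex.norm_real, Real.norm_eq_abs, abs_of_nonneg
    (by positivity), div_mul_cancel₀ _ (norm_ne_zero_iff.2 hy)] at h
  linarith

end Criteria

/-! ### Monomial integrals and the Taylor coefficient inequality -/

theorem fockIntegrand_nonneg (p α m : ℝ) (f : ℂ → ℂ) (z : ℂ) : 0 ≤ fockIntegrand p α m f z := by
  unfold fockIntegrand
  positivity

theorem continuous_fockIntegrand {p m : ℝ} (hp : 0 ≤ p) (hm : 0 < m) (α : ℝ) {f : ℂ → ℂ}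
    (hf : Continuous f) : Continuous (fockIntegrand p α m f) := by
  unfold fockIntegrand
  have h1 : Continuous fun z : ℂ => ‖f z‖ ^ p := hf.norm.rpow_const fun _ => Or.inr hp
  have h2 : Continuous fun z : ℂ => ‖z‖ ^ m := continuous_norm.rpow_const fun _ => Or.inr hm.le
  fun_prop

theorem integral_norm_rpow_mul_exp_neg_mul_norm_rpow {q b m : ℝ} (hm : 0 < m) (hq : -2 < q)
    (hb : 0 < b) :
    ∫ z : ℂ, ‖z‖ ^ q * Real.exp (-(b * ‖z‖ ^ m)) =
      2 * Real.pi / m * b ^ (-(q + 2) / m) * Real.Gamma ((q + 2) / m) := by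
  rw [integral_fun_norm_addHaar volume (fun x : ℝ => x ^ q * Real.exp (-(b * x ^ m)))]
  have h1 : ∫ y in Set.Ioi (0 : ℝ),
      y ^ (Module.finrank ℝ ℂ - 1) • (y ^ q * Real.exp (-(b * y ^ m))) =
      ∫ y in Set.Ioi (0 : ℝ), y ^ (q + 1) * Real.exp (-b * y ^ m) := by
    refine setIntegral_congr_fun measurableSet_Ioi fun y hy => ?_
    simp only [Complex.finrank_real_complex, smul_eq_mul, Nat.reduceSub, pow_one]
    rw [Real.rpow_add_one (ne_of_gt hy), neg_mul]
    ring
  rw [h1, integral_rpow_mul_exp_neg_mul_rpow hm (by linarith) hb, Complex.finrank_real_complex]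
  have h2 : (volume : Measure ℂ).real (Metric.ball 0 1) = Real.pi := by
    simp [Measure.real, Complex.volume_ball]
  rw [h2, add_assoc, one_add_one_eq_two]
  simp only [nsmul_eq_mul, smul_eq_mul]
  push_cast
  ring

theorem integral_fockIntegrand_pow {p α m : ℝ} (hp : 0 < p) (hα : 0 < α) (hm : 0 < m) (n : ℕ) :
    ∫ z, fockIntegrand p α m (fun z => z ^ n) z =
      2 * Real.pi / m * (p * α) ^ (-(n * p + 2) / m) * Real.Gamma ((n * p + 2) / m) := by
  rw [← integral_norm_rpow_mul_exp_neg_mul_norm_rpow hm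
    (by have : 0 ≤ n * p := by positivity
        linarith) (mul_pos hp hα)]
  congr 1
  ext z
  rw [fockIntegrand, norm_pow, ← Real.rpow_natCast, ← Real.rpow_mul (norm_nonneg _)]

theorem integral_fockIntegrand_pow_pos {p α m : ℝ} (hp : 0 < p) (hα : 0 < α) (hm : 0 < m)
    (n : ℕ) : 0 < ∫ z, fockIntegrand p α m (fun z => z ^ n) z := by
  rw [integral_fockIntegrand_pow hp hα hm]
  have := Real.pi_pos
  have := Real.Gamma_pos_of_pos (by positivity : 0 < (n * p + 2) / m)
  positivity

/-- A non-integrable function has Bochner integral `0` by convention, whereas this integral was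
computed to be positive. -/
theorem integrable_fockIntegrand_pow {p α m : ℝ} (hp : 0 < p) (hα : 0 < α) (hm : 0 < m)
    (n : ℕ) : Integrable (fockIntegrand p α m (fun z => z ^ n)) volume := by
  by_contra h
  exact (integral_fockIntegrand_pow_pos hp hα hm n).ne' (integral_undef h)

theorem iteratedDeriv_zero_eq_factorial_mul_cauchyPowerSeries {g : ℂ → ℂ}
    (hg : Differentiable ℂ g) (n : ℕ) :
    iteratedDeriv n g 0 = n.factorial * cauchyPowerSeries g 0 1 n fun _ => 1 := by
  have h := (hg.differentiableOn.hasFPowerSeriesOnBall (R := 1) (c := 0) one_pos).factorial_smul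
    (1 : ℂ) n
  rw [iteratedDeriv_eq_iteratedFDeriv, ← h]
  simp

/-- Cauchy's formula on the unit circle for `w ↦ f (z * w)`. Fixing the radius at 1 includes `z = 0`
and presents the mean as one over rotations of `z`. -/
theorem norm_iteratedDeriv_mul_pow_le_circle_average {f : ℂ → ℂ} (hf : Differentiable ℂ f)
    (n : ℕ) (z : ℂ) :
    ‖((n.factorial : ℂ)⁻¹ * iteratedDeriv n f 0) * z ^ n‖ ≤
      (2 * Real.pi)⁻¹ * ∫ θ in (0 : ℝ)..2 * Real.pi, ‖f (circleMap 0 1 θ * z)‖ := by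
  have hg : Differentiable ℂ fun w => f (z * w) := hf.comp (differentiable_id.const_mul z)
  have h1 := iteratedDeriv_zero_eq_factorial_mul_cauchyPowerSeries hg n
  rw [iteratedDeriv_comp_const_mul hf.contDiff] at h1
  simp only [mul_zero] at h1
  have hn : (n.factorial : ℂ) ≠ 0 := by exact_mod_cast n.factorial_ne_zero
  have h2 : ((n.factorial : ℂ)⁻¹ * iteratedDeriv n f 0) * z ^ n =
      cauchyPowerSeries (fun w => f (z * w)) 0 1 n fun _ => 1 := by
    rw [mul_assoc, mul_comm (iteratedDeriv n f 0), h1, inv_mul_cancel_left₀ hn]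
  rw [h2]
  refine (ContinuousMultilinearMap.le_opNorm _ _).trans ?_
  have h3 := norm_cauchyPowerSeries_le (fun w => f (z * w)) 0 1 n
  simpa [mul_comm z] using h3

theorem measurePreserving_circleMap_mul (θ : ℝ) :
    MeasurePreserving (fun z : ℂ => circleMap 0 1 θ * z) volume volume := by
  have h : (fun z : ℂ => circleMap 0 1 θ * z) = rotation (Circle.exp θ) := by
    ext z
    simp [circleMap]
  rw [h]
  exact (rotation (Circle.exp θ)).measurePreserving

theorem measurableEmbedding_circleMap_mul (θ : ℝ) :
    MeasurableEmbedding (fun z : ℂ => circleMap 0 1 θ * z) := by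
  have h := (rotation (Circle.exp θ)).toHomeomorph.measurableEmbedding
  convert h using 1
  ext z
  simp [circleMap]

/-- Jensen's inequality for `x ^ p` applied to the circle mean; the weight is radial, so it passes
through the average. -/
theorem fockIntegrand_le_circle_average {p α m : ℝ} (hp : 1 ≤ p) {f : ℂ → ℂ}
    (hf : Differentiable ℂ f) (n : ℕ) (z : ℂ) :
    fockIntegrand p α m (fun z => ((n.factorial : ℂ)⁻¹ * iteratedDeriv n f 0) * z ^ n) z ≤
      ⨍ θ in Set.Ioc 0 (2 * Real.pi), fockIntegrand p α m f (circleMap 0 1 θ * z) := by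
  have hpi := Real.pi_pos
  have hp0 : 0 ≤ p := by linarith
  have hc : Continuous fun θ : ℝ => ‖f (circleMap 0 1 θ * z)‖ := by
    have := hf.continuous
    fun_prop
  have hc' : Continuous fun θ : ℝ => ‖f (circleMap 0 1 θ * z)‖ ^ p :=
    hc.rpow_const fun _ => Or.inr hp0
  have hvol : volume (Set.Ioc 0 (2 * Real.pi)) ≠ 0 := by simp [hpi]
  have hJ := (convexOn_rpow hp).map_set_average_le (μ := volume)
    (t := Set.Ioc 0 (2 * Real.pi)) (f := fun θ : ℝ => ‖f (circleMap 0 1 θ * z)‖)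
    (continuousOn_id.rpow_const fun _ _ => Or.inr hp0) isClosed_Ici hvol
    measure_Ioc_lt_top.ne (Eventually.of_forall fun _ => norm_nonneg _)
    (hc.integrableOn_Ioc) (hc'.integrableOn_Ioc)
  have hb := norm_iteratedDeriv_mul_pow_le_circle_average hf n z
  have havg : (2 * Real.pi)⁻¹ * ∫ θ in (0 : ℝ)..2 * Real.pi, ‖f (circleMap 0 1 θ * z)‖ =
      ⨍ θ in Set.Ioc 0 (2 * Real.pi), ‖f (circleMap 0 1 θ * z)‖ := by
    rw [setAverage_eq, intervalIntegral.integral_of_le (by positivity)]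
    simp [Measure.real, hpi.le]
  rw [havg] at hb
  have hw : ∀ θ, fockIntegrand p α m f (circleMap 0 1 θ * z) =
      ‖f (circleMap 0 1 θ * z)‖ ^ p * Real.exp (-(p * α * ‖z‖ ^ m)) := by
    intro θ
    simp [fockIntegrand]
  simp only [hw]
  rw [setAverage_eq, integral_mul_const, ← smul_mul_assoc, ← setAverage_eq]
  unfold fockIntegrand
  gcongr
  exact (Real.rpow_le_rpow (norm_nonneg _) hb hp0).trans hJ

/-- Integrate the pointwise bound in `z` and exchange the integrals: by rotation invariance of area,
every angle contributes the same integral. Thus projecting to a single Taylor term is a contraction.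
-/
theorem integral_fockIntegrand_taylor_le {p α m : ℝ} (hp : 1 ≤ p) (hα : 0 < α) (hm : 0 < m)
    {f : ℂ → ℂ} (hf : Differentiable ℂ f) (hfi : Integrable (fockIntegrand p α m f) volume)
    (n : ℕ) :
    ∫ z, fockIntegrand p α m
      (fun z => ((n.factorial : ℂ)⁻¹ * iteratedDeriv n f 0) * z ^ n) z ≤
      ∫ z, fockIntegrand p α m f z := by
  have hpi := Real.pi_pos
  have hp0 : 0 < p := by linarith
  set c := (n.factorial : ℂ)⁻¹ * iteratedDeriv n f 0 with hc
  have hrot : ∀ θ : ℝ, ∫ z, fockIntegrand p α m f (circleMap 0 1 θ * z) =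
      ∫ z, fockIntegrand p α m f z := fun θ =>
    (measurePreserving_circleMap_mul θ).integral_comp (measurableEmbedding_circleMap_mul θ) _
  have hroti : ∀ θ : ℝ, Integrable (fun z => fockIntegrand p α m f (circleMap 0 1 θ * z)) :=
    fun θ => (measurePreserving_circleMap_mul θ).integrable_comp_emb
      (measurableEmbedding_circleMap_mul θ) |>.2 hfi
  have hcont := continuous_fockIntegrand hp0.le hm α hf.continuous
  have hprod : Integrable (fun q : ℝ × ℂ => fockIntegrand p α m f (circleMap 0 1 q.1 * q.2))
      ((volume.restrict (Set.Ioc 0 (2 * Real.pi))).prod volume) := by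
    rw [integrable_prod_iff (by
      refine Continuous.aestronglyMeasurable ?_
      have := continuous_circleMap 0 1
      fun_prop)]
    refine ⟨Eventually.of_forall hroti, ?_⟩
    simp only [Real.norm_eq_abs, abs_of_nonneg (fockIntegrand_nonneg _ _ _ _ _), hrot]
    exact integrable_const _
  have hintc : Integrable (fockIntegrand p α m (fun z => c * z ^ n)) volume := by
    have : fockIntegrand p α m (fun z => c * z ^ n) =
        fun z => ‖c‖ ^ p * fockIntegrand p α m (fun z => z ^ n) z := by
      ext z
      rw [fockIntegrand, fockIntegrand, norm_mul, Real.mul_rpow (norm_nonneg _) (norm_nonneg _)]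
      ring
    rw [this]
    exact (integrable_fockIntegrand_pow hp0 hα hm n).const_mul _
  calc _ ≤ ∫ z, ⨍ θ in Set.Ioc 0 (2 * Real.pi), fockIntegrand p α m f (circleMap 0 1 θ * z) := by
        refine integral_mono hintc ?_ fun z => fockIntegrand_le_circle_average hp hf n z
        simp only [setAverage_eq]
        exact Integrable.smul (𝕜 := ℝ) _ hprod.integral_prod_right
    _ = ∫ z, fockIntegrand p α m f z := by
        simp only [setAverage_eq]
        rw [integral_smul, ← integral_integral_swap hprod]
        simp only [hrot]
        simp [Measure.real, hpi.le]
        field_simp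

namespace FockSpace

variable {p α m : ℝ} [hp : Fact (1 ≤ p)]

theorem exponent_pos : 0 < p := one_pos.trans_le hp.out

@[ext]
theorem ext {f g : FockSpace p α m} (h : ∀ z, f z = g z) : f = g :=
  Subtype.ext (funext h)

@[simp]
theorem zero_apply (z : ℂ) : (0 : FockSpace p α m) z = 0 := rfl

theorem differentiable (f : FockSpace p α m) : Differentiable ℂ f := f.2.1

theorem integrable (f : FockSpace p α m) : Integrable (fockIntegrand p α m f) := f.2.2

theorem norm_eq_integral (f : FockSpace p α m) :
    ‖f‖ = (∫ z, fockIntegrand p α m f z) ^ (1 / p) := rfl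

/-- An entire function with finite weighted integral, as an element of the Fock space. -/
def mk (f : ℂ → ℂ) (hf : Differentiable ℂ f) (hfi : Integrable (fockIntegrand p α m f) volume) :
    FockSpace p α m := ⟨f, hf, hfi⟩

/-- The normalised monomials `zⁿ / n!`. -/
def monomial (hα : 0 < α) (hm : 0 < m) (n : ℕ) : FockSpace p α m :=
  ((n.factorial : ℂ)⁻¹) • mk (fun z => z ^ n) (by fun_prop)
    (integrable_fockIntegrand_pow exponent_pos hα hm n)

variable (hα : 0 < α) (hm : 0 < m)

@[simp]
theorem monomial_apply (n : ℕ) (z : ℂ) :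
    (monomial hα hm n : FockSpace p α m) z = (n.factorial : ℂ)⁻¹ * z ^ n := rfl

theorem norm_monomial (n : ℕ) : ‖(monomial hα hm n : FockSpace p α m)‖ =
    (n.factorial : ℝ)⁻¹ * (∫ z, fockIntegrand p α m (fun z => z ^ n) z) ^ (1 / p) := by
  rw [monomial, norm_smul, norm_inv, Complex.norm_natCast]
  rfl

theorem norm_monomial_pos (n : ℕ) : 0 < ‖(monomial hα hm n : FockSpace p α m)‖ := by
  rw [norm_monomial]
  have := integral_fockIntegrand_pow_pos (exponent_pos (p := p)) hα hm n
  positivity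

theorem norm_iteratedDeriv_mul_norm_monomial_le (f : FockSpace p α m) (n : ℕ) :
    ‖iteratedDeriv n f 0‖ * ‖(monomial hα hm n : FockSpace p α m)‖ ≤ ‖f‖ := by
  rw [← norm_smul, norm_eq_integral, norm_eq_integral]
  refine Real.rpow_le_rpow (integral_nonneg (fockIntegrand_nonneg _ _ _ _)) ?_
    (one_div_nonneg.2 exponent_pos.le)
  have h : ((iteratedDeriv n f 0 • (monomial hα hm n : FockSpace p α m) : FockSpace p α m) :
      ℂ → ℂ) = fun z => ((n.factorial : ℂ)⁻¹ * iteratedDeriv n f 0) * z ^ n := by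
    ext z
    change iteratedDeriv n f 0 * ((n.factorial : ℂ)⁻¹ * z ^ n) = _
    ring
  rw [h]
  exact integral_fockIntegrand_taylor_le hp.out hα hm f.differentiable f.integrable n

end FockSpace

/-! ### Point evaluations and completeness -/

namespace FockSpace

variable {p α m : ℝ} [hp : Fact (1 ≤ p)]

/-- On `‖z‖ > R` one has `‖z ^ n‖ ≥ R ^ n`, and the weight has positive mass there, independent of
`n`. With the Taylor coefficient inequality this gives Cauchy-type estimates at every radius. -/
theorem exists_mul_pow_le_norm_monomial (hα : 0 < α) (hm : 0 < m) {R : ℝ} (hR : 0 < R) :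
    ∃ c > 0, ∀ n : ℕ, c * R ^ n ≤ n.factorial * ‖(monomial hα hm n : FockSpace p α m)‖ := by
  have hp0 : 0 < p := exponent_pos
  set A : Set ℂ := {z | R < ‖z‖} with hA
  have hAo : IsOpen A := isOpen_lt continuous_const continuous_norm
  have hint := integrable_fockIntegrand_pow hp0 hα hm
  have hone : ∀ z, fockIntegrand p α m (fun z => z ^ 0) z =
      Real.exp (-(p * α * ‖z‖ ^ m)) := by
    intro z
    simp [fockIntegrand]
  set I := ∫ z in A, fockIntegrand p α m (fun z => z ^ 0) z with hI
  have hIpos : 0 < I := by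
    rw [hI, setIntegral_pos_iff_support_of_nonneg_ae
      (Eventually.of_forall fun z => fockIntegrand_nonneg _ _ _ _ z) (hint 0).integrableOn]
    have hsupp : Function.support (fockIntegrand p α m (fun z => z ^ 0)) = Set.univ := by
      ext z
      simp only [Function.mem_support, hone, Set.mem_univ, iff_true]
      positivity
    rw [hsupp, Set.univ_inter]
    refine hAo.measure_pos _ ⟨((R + 1 : ℝ) : ℂ), ?_⟩
    rw [hA, Set.mem_ofPred_eq, Complex.norm_real, Real.norm_eq_abs, abs_of_pos (by linarith)]
    linarith
  refine ⟨I ^ (1 / p), by positivity, fun n => ?_⟩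
  have hle : (R ^ n) ^ p * I ≤ ∫ z, fockIntegrand p α m (fun z => z ^ n) z := by
    rw [hI, ← integral_const_mul]
    calc _ ≤ ∫ z in A, fockIntegrand p α m (fun z => z ^ n) z := by
          refine setIntegral_mono_on ((hint 0).integrableOn.const_mul _) (hint n).integrableOn
            hAo.measurableSet fun z hz => ?_
          rw [hone, fockIntegrand, norm_pow]
          have : R ≤ ‖z‖ := le_of_lt hz
          gcongr
      _ ≤ _ := setIntegral_le_integral (hint n)
          (Eventually.of_forall fun z => fockIntegrand_nonneg _ _ _ _ z)
  rw [norm_monomial, mul_inv_cancel_left₀ (by positivity), mul_comm]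
  calc R ^ n * I ^ (1 / p) = ((R ^ n) ^ p * I) ^ (1 / p) := by
        rw [Real.mul_rpow (by positivity) hIpos.le, ← Real.rpow_mul (by positivity),
          mul_one_div_cancel hp0.ne', Real.rpow_one]
    _ ≤ _ := Real.rpow_le_rpow (by positivity) hle (by positivity)

theorem hasSum_taylor (f : FockSpace p α m) (z : ℂ) :
    HasSum (fun n : ℕ => iteratedDeriv n f 0 * ((n.factorial : ℂ)⁻¹ * z ^ n)) (f z) := by
  have h := Complex.hasSum_taylorSeries_of_entire f.differentiable 0 z
  have e : (fun n : ℕ => (n.factorial : ℂ)⁻¹ • (z - 0) ^ n • iteratedDeriv n f 0) =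
      fun n : ℕ => iteratedDeriv n f 0 * ((n.factorial : ℂ)⁻¹ * z ^ n) := by
    ext n
    simp only [sub_zero, smul_eq_mul]
    ring
  rwa [e] at h

theorem exists_norm_apply_le (hα : 0 < α) (hm : 0 < m) {R : ℝ} (hR : 0 < R) :
    ∃ C : ℝ, ∀ (f : FockSpace p α m) (z : ℂ), ‖z‖ ≤ R → ‖f z‖ ≤ C * ‖f‖ := by
  -- With radius `2 * R`, the Taylor terms on `‖z‖ ≤ R` are dominated by a geometric series of ratio
  -- `1 / 2`.
  obtain ⟨c, hc, hcn⟩ := exists_mul_pow_le_norm_monomial (p := p) hα hm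
    (mul_pos two_pos hR)
  refine ⟨2 / c, fun f z hz => ?_⟩
  have hs : HasSum (fun n : ℕ => ‖f‖ / c * (1 / 2 : ℝ) ^ n) (‖f‖ / c * 2) :=
    hasSum_geometric_two.mul_left _
  have h := (hasSum_taylor f z).norm_le_of_bounded hs fun n => ?_
  · calc _ ≤ ‖f‖ / c * 2 := h
      _ = _ := by ring
  · have h1 := norm_iteratedDeriv_mul_norm_monomial_le hα hm f n
    have h2 := hcn n
    have hfac : (0 : ℝ) < n.factorial := by positivity
    have h3 : ‖iteratedDeriv n f 0‖ * (c * (2 * R) ^ n) ≤ n.factorial * ‖f‖ := by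
      calc _ ≤ ‖iteratedDeriv n f 0‖ *
            (n.factorial * ‖(monomial hα hm n : FockSpace p α m)‖) := by gcongr
        _ = n.factorial *
            (‖iteratedDeriv n f 0‖ * ‖(monomial hα hm n : FockSpace p α m)‖) := by ring
        _ ≤ _ := by gcongr
    rw [norm_mul, norm_mul, norm_inv, Complex.norm_natCast, norm_pow]
    calc ‖iteratedDeriv n f 0‖ * ((n.factorial : ℝ)⁻¹ * ‖z‖ ^ n)
        ≤ ‖iteratedDeriv n f 0‖ * ((n.factorial : ℝ)⁻¹ * R ^ n) := by gcongr
      _ = ‖iteratedDeriv n f 0‖ * (c * (2 * R) ^ n) *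
          ((n.factorial : ℝ)⁻¹ * (c⁻¹ * (1 / 2) ^ n)) := by
          rw [mul_pow, one_div, inv_pow]
          field_simp
      _ ≤ n.factorial * ‖f‖ * ((n.factorial : ℝ)⁻¹ * (c⁻¹ * (1 / 2) ^ n)) := by gcongr
      _ = _ := by field_simp

/-- Point evaluation as a continuous linear functional. -/
def eval (hα : 0 < α) (hm : 0 < m) (z : ℂ) : FockSpace p α m →L[ℂ] ℂ :=
  LinearMap.mkContinuousOfExistsBound
    { toFun := fun f => f z
      map_add' := fun _ _ => rfl
      map_smul' := fun _ _ => rfl }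
    (by
      obtain ⟨C, hC⟩ := exists_norm_apply_le (p := p) hα hm (R := ‖z‖ + 1) (by positivity)
      exact ⟨C, fun f => hC f z (by linarith)⟩)

@[simp]
theorem eval_apply (hα : 0 < α) (hm : 0 < m) (z : ℂ) (f : FockSpace p α m) :
    eval hα hm z f = f z := rfl

instance : Fact (1 ≤ ENNReal.ofReal p) :=
  ⟨by rw [← ENNReal.ofReal_one]; exact ENNReal.ofReal_le_ofReal hp.out⟩

theorem fockWeighted_sub (f g : FockSpace p α m) :
    fockWeighted α m (f - g : FockSpace p α m) = fockWeighted α m f - fockWeighted α m g := by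
  funext z
  exact mul_sub _ _ _

theorem norm_sub_eq_norm_toLp_sub (f g : FockSpace p α m) :
    ‖f - g‖ = ‖f.memLp.toLp - g.memLp.toLp‖ := by
  rw [← MemLp.toLp_sub, Lp.norm_toLp, norm_eq, fockWeighted_sub]

/-- Point evaluations are bounded uniformly on compact sets, so norm-Cauchy sequences converge
locally uniformly and Weierstrass' theorem applies. -/
theorem exists_entire_limit (hα : 0 < α) (hm : 0 < m) {u : ℕ → FockSpace p α m}
    (hu : CauchySeq u) :
    ∃ F : ℂ → ℂ, Differentiable ℂ F ∧ ∀ z, Tendsto (fun k => u k z) atTop (𝓝 (F z)) := by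
  have hlim : ∀ z, ∃ w, Tendsto (fun k => u k z) atTop (𝓝 w) := fun z =>
    cauchySeq_tendsto_of_complete ((eval hα hm z).uniformContinuous.comp_cauchySeq hu)
  choose F hF using hlim
  refine ⟨F, ?_, hF⟩
  have hunif : TendstoLocallyUniformlyOn (fun k => (u k : ℂ → ℂ)) F atTop Set.univ := by
    rw [tendstoLocallyUniformlyOn_univ, tendstoLocallyUniformly_iff_forall_isCompact]
    intro K hK
    obtain ⟨R, hR⟩ := hK.isBounded.exists_norm_le
    obtain ⟨C, hC⟩ := exists_norm_apply_le (p := p) hα hm (R := |R| + 1) (by positivity)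
    refine UniformCauchySeqOn.tendstoUniformlyOn_of_tendsto ?_ fun z _ => hF z
    rw [Metric.uniformCauchySeqOn_iff]
    intro ε hε
    obtain ⟨N, hN⟩ := Metric.cauchySeq_iff.1 hu (ε / (|C| + 1)) (by positivity)
    refine ⟨N, fun i hi j hj z hz => ?_⟩
    have h1 := hN i hi j hj
    rw [dist_eq_norm, lt_div_iff₀ (by positivity)] at h1
    have h2 := hC (u i - u j) z ((hR z hz).trans (by linarith [le_abs_self R]))
    rw [dist_eq_norm]
    calc ‖u i z - u j z‖ ≤ C * ‖u i - u j‖ := h2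
      _ ≤ ‖u i - u j‖ * (|C| + 1) := by
        rw [mul_comm]
        gcongr
        linarith [le_abs_self C]
      _ < ε := h1
  rw [← differentiableOn_univ]
  exact hunif.differentiableOn (Eventually.of_forall fun k => (u k).differentiable.differentiableOn)
    isOpen_univ

/-- Multiplication by the weight embeds the space isometrically in `L^p`. An almost everywhere
convergent subsequence identifies the `L^p` limit with the weighted entire limit. -/
theorem completeSpace (hα : 0 < α) (hm : 0 < m) : CompleteSpace (FockSpace p α m) := by
  refine Metric.complete_of_cauchySeq_tendsto fun u hu => ?_
  obtain ⟨F, hFd, hF⟩ := exists_entire_limit hα hm hu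
  have hcauchy : CauchySeq fun k => (u k).memLp.toLp := by
    rw [Metric.cauchySeq_iff] at hu ⊢
    intro ε hε
    obtain ⟨N, hN⟩ := hu ε hε
    refine ⟨N, fun i hi j hj => ?_⟩
    rw [dist_eq_norm, ← norm_sub_eq_norm_toLp_sub, ← dist_eq_norm]
    exact hN i hi j hj
  obtain ⟨G, hG⟩ := cauchySeq_tendsto_of_complete hcauchy
  obtain ⟨φ, hφ, hφG⟩ := (tendstoInMeasure_of_tendsto_Lp hG).exists_seq_tendsto_ae
  have hFG : (G : ℂ → ℂ) =ᵐ[volume] fockWeighted α m F := by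
    have hcoe : ∀ᵐ z : ℂ, ∀ k, ((u k).memLp.toLp : Lp ℂ (ENNReal.ofReal p) volume) z = fockWeighted α m (u k) z :=
      ae_all_iff.2 fun k => (u k).memLp.coeFn_toLp
    filter_upwards [hφG, hcoe] with z hz hzc
    simp only [hzc] at hz
    exact tendsto_nhds_unique hz (((hF z).comp hφ.tendsto_atTop).const_mul _)
  have hFm : MemLp (fockWeighted α m F) (ENNReal.ofReal p) volume :=
    (memLp_congr_ae hFG).1 (Lp.memLp G)
  let f : FockSpace p α m :=
    mk F hFd ((integrable_fockIntegrand_iff hp.out α m hFd.continuous).2 hFm)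
  refine ⟨f, ?_⟩
  have hfG : f.memLp.toLp = G := by
    rw [← Lp.toLp_coeFn G (Lp.memLp G)]
    exact MemLp.toLp_eq_toLp_iff _ _ |>.2 hFG.symm
  rw [tendsto_iff_norm_sub_tendsto_zero] at hG ⊢
  simpa only [norm_sub_eq_norm_toLp_sub, hfG] using hG

end FockSpace

/-! ### Dilations and density of the polynomials -/

/-- A generalised dominated convergence theorem: the dominating functions may vary, provided that
their integrals converge to the integral of their limit. -/
theorem tendsto_integral_zero_of_le_of_tendsto {Ω : Type*} [MeasurableSpace Ω] {μ : Measure Ω}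
    {B H : ℕ → Ω → ℝ} {G : Ω → ℝ} (hB : ∀ k, Integrable (B k) μ) (hH : ∀ k, Integrable (H k) μ)
    (hG : Integrable G μ) (hB0 : ∀ k x, 0 ≤ B k x) (hBH : ∀ k x, B k x ≤ H k x)
    (hBlim : ∀ x, Tendsto (fun k => B k x) atTop (𝓝 0))
    (hHlim : ∀ x, Tendsto (fun k => H k x) atTop (𝓝 (G x)))
    (hint : Tendsto (fun k => ∫ x, H k x ∂μ) atTop (𝓝 (∫ x, G x ∂μ))) :
    Tendsto (fun k => ∫ x, B k x ∂μ) atTop (𝓝 0) := by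
  have hG0 : ∀ x, 0 ≤ G x := fun x =>
    ge_of_tendsto' (hHlim x) fun k => (hB0 k x).trans (hBH k x)
  -- The proof rests on `B ≤ min B G + (H - G) + max (G - H) 0`. The first and last terms are
  -- dominated by `G`; the middle one is handled by the convergence of the integrals.
  have hmin : Tendsto (fun k => ∫ x, min (B k x) (G x) ∂μ) atTop (𝓝 0) := by
    have := tendsto_integral_of_dominated_convergence (μ := μ) (F := fun k x => min (B k x) (G x))
      (f := fun _ => 0) G (fun k => ((hB k).inf hG).1) hG
      (fun k => Eventually.of_forall fun x => by
        rw [Real.norm_eq_abs, abs_of_nonneg (le_min (hB0 k x) (hG0 x))]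
        exact min_le_right _ _)
      (Eventually.of_forall fun x => by
        have := (hBlim x).min (tendsto_const_nhds (x := G x))
        rwa [min_eq_left (hG0 x)] at this)
    simpa using this
  have hmax : Tendsto (fun k => ∫ x, max (G x - H k x) 0 ∂μ) atTop (𝓝 0) := by
    have := tendsto_integral_of_dominated_convergence (μ := μ)
      (F := fun k x => max (G x - H k x) 0)
      (f := fun _ => 0) G (fun k => ((hG.sub (hH k)).pos_part).1) hG
      (fun k => Eventually.of_forall fun x => by
        rw [Real.norm_eq_abs, abs_of_nonneg (le_max_right _ _)]
        exact max_le (by linarith [(hB0 k x).trans (hBH k x)]) (hG0 x))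
      (Eventually.of_forall fun x => by
        have := ((hHlim x).const_sub (G x)).max (tendsto_const_nhds (x := (0 : ℝ)))
        simpa using this)
    simpa using this
  have hsum := (hmin.add (hint.sub_const (∫ x, G x ∂μ))).add hmax
  rw [sub_self, add_zero, add_zero] at hsum
  refine squeeze_zero (fun k => integral_nonneg (hB0 k)) (fun k => ?_) hsum
  have hi1 : Integrable (fun x => min (B k x) (G x)) μ := (hB k).inf hG
  have hi2 : Integrable (fun x => max (G x - H k x) 0) μ := (hG.sub (hH k)).pos_part
  have hi0 : Integrable (fun x => H k x - G x) μ := (hH k).sub hG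
  have hi3 : Integrable (fun x => min (B k x) (G x) + (H k x - G x)) μ := hi1.add hi0
  rw [← integral_sub (hH k) hG, ← integral_add hi1 hi0, ← integral_add hi3 hi2]
  refine integral_mono (hB k) (hi3.add hi2) fun x => ?_
  rcases le_total (B k x) (G x) with h | h
  · rw [min_eq_left h]
    linarith [le_max_left (G x - H k x) 0]
  · rw [min_eq_right h]
    linarith [le_max_right (G x - H k x) 0, hBH k x]

namespace FockSpace

variable {p α m : ℝ} [hp : Fact (1 ≤ p)]

theorem fockIntegrand_dilation_le (hα : 0 < α) (hm : 0 < m) (f : ℂ → ℂ) {r : ℝ} (hr0 : 0 ≤ r)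
    (hr1 : r ≤ 1) (z : ℂ) :
    fockIntegrand p α m (fun z => f (r • z)) z ≤ fockIntegrand p α m f (r • z) := by
  have hp0 : 0 < p := exponent_pos
  have h : ‖r • z‖ ^ m ≤ ‖z‖ ^ m := by
    refine Real.rpow_le_rpow (norm_nonneg _) ?_ hm.le
    rw [norm_smul, Real.norm_eq_abs, abs_of_nonneg hr0]
    exact mul_le_of_le_one_left (norm_nonneg _) hr1
  unfold fockIntegrand
  gcongr

/-- The dilation `z ↦ f (r z)`. -/
def dilation (hα : 0 < α) (hm : 0 < m) {r : ℝ} (hr : r ∈ Set.Ioo (0 : ℝ) 1)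
    (f : FockSpace p α m) : FockSpace p α m :=
  mk (fun z => f (r • z)) (f.differentiable.comp (by fun_prop)) (by
    refine (f.integrable.comp_smul hr.1.ne').mono'
      (continuous_fockIntegrand exponent_pos.le hm α
        (f.differentiable.continuous.comp (by fun_prop))).aestronglyMeasurable
      (Eventually.of_forall fun z => ?_)
    rw [Real.norm_eq_abs, abs_of_nonneg (fockIntegrand_nonneg _ _ _ _ _)]
    exact fockIntegrand_dilation_le hα hm f hr.1.le hr.2.le z)

@[simp]
theorem dilation_apply (hα : 0 < α) (hm : 0 < m) {r : ℝ} (hr : r ∈ Set.Ioo (0 : ℝ) 1)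
    (f : FockSpace p α m) (z : ℂ) : dilation hα hm hr f z = f (r • z) := rfl

theorem fockIntegrand_sub_le (f g : FockSpace p α m) (z : ℂ) :
    fockIntegrand p α m (f - g : FockSpace p α m) z ≤
      2 ^ (p - 1) * (fockIntegrand p α m f z + fockIntegrand p α m g z) := by
  have hp1 : 1 ≤ p := hp.out
  have h : ‖f z - g z‖ ^ p ≤ 2 ^ (p - 1) * (‖f z‖ ^ p + ‖g z‖ ^ p) :=
    (Real.rpow_le_rpow (norm_nonneg _) (norm_sub_le _ _) exponent_pos.le).trans
      (by
        exact_mod_cast NNReal.rpow_add_le_mul_rpow_add_rpow ‖f z‖₊ ‖g z‖₊ hp1)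
  calc _ = ‖f z - g z‖ ^ p * Real.exp (-(p * α * ‖z‖ ^ m)) := rfl
    _ ≤ 2 ^ (p - 1) * (‖f z‖ ^ p + ‖g z‖ ^ p) * Real.exp (-(p * α * ‖z‖ ^ m)) := by gcongr
    _ = _ := by
      unfold fockIntegrand
      ring

/-- The natural majorant of the dilated integrand is the original integrand at `r k • z`. It varies
with `k`, but its integral is `r k ^ (-2)` times a constant, so generalised dominated convergence
applies. -/
theorem tendsto_dilation (hα : 0 < α) (hm : 0 < m) {r : ℕ → ℝ}
    (hr : ∀ k, r k ∈ Set.Ioo (0 : ℝ) 1) (hr1 : Tendsto r atTop (𝓝 1)) (f : FockSpace p α m) :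
    Tendsto (fun k => dilation hα hm (hr k) f) atTop (𝓝 f) := by
  have hp0 : 0 < p := exponent_pos
  have hcont := continuous_fockIntegrand hp0.le hm α f.differentiable.continuous
  have hrz : ∀ z : ℂ, Tendsto (fun k => r k • z) atTop (𝓝 z) := fun z => by
    simpa using hr1.smul_const z
  have hint : Tendsto (fun k => ∫ z, fockIntegrand p α m f (r k • z)) atTop
      (𝓝 (∫ z, fockIntegrand p α m f z)) := by
    have h : ∀ k, ∫ z, fockIntegrand p α m f (r k • z) =
        (r k ^ 2)⁻¹ * ∫ z, fockIntegrand p α m f z := fun k => by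
      rw [Measure.integral_comp_smul_of_nonneg volume _ _ (hR := (hr k).1.le), Complex.finrank_real_complex,
        smul_eq_mul]
    simp only [h]
    have := ((hr1.pow 2).inv₀ (by norm_num)).mul_const (∫ z, fockIntegrand p α m f z)
    simpa using this
  have hlim : Tendsto (fun k => ∫ z, fockIntegrand p α m (dilation hα hm (hr k) f - f :
      FockSpace p α m) z) atTop (𝓝 0) := by
    refine tendsto_integral_zero_of_le_of_tendsto
      (H := fun k z => 2 ^ (p - 1) * (fockIntegrand p α m f (r k • z) + fockIntegrand p α m f z))
      (G := fun z => 2 ^ (p - 1) * (fockIntegrand p α m f z + fockIntegrand p α m f z))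
      (fun k => FockSpace.integrable _)
      (fun k => ((f.integrable.comp_smul (hr k).1.ne').add f.integrable).const_mul _)
      ((f.integrable.add f.integrable).const_mul _)
      (fun k z => fockIntegrand_nonneg _ _ _ _ _) (fun k z => ?_) (fun z => ?_) (fun z => ?_) ?_
    · refine (fockIntegrand_sub_le _ _ z).trans ?_
      gcongr
      exact fockIntegrand_dilation_le hα hm f (hr k).1.le (hr k).2.le z
    · have h1 : Tendsto (fun k => f (r k • z) - f z) atTop (𝓝 0) := by
        simpa using ((f.differentiable.continuous.tendsto z).comp (hrz z)).sub_const (f z)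
      have h2 := (h1.norm.rpow_const (p := p) (Or.inr hp0.le)).mul_const
        (Real.exp (-(p * α * ‖z‖ ^ m)))
      rw [norm_zero, Real.zero_rpow hp0.ne', zero_mul] at h2
      exact h2
    · exact (((hcont.tendsto z).comp (hrz z)).add_const _).const_mul _
    · simp only [integral_const_mul]
      refine Tendsto.const_mul _ ?_
      rw [integral_add f.integrable f.integrable]
      refine (hint.add_const (∫ z, fockIntegrand p α m f z)).congr fun k => ?_
      rw [integral_add (f.integrable.comp_smul (hr k).1.ne') f.integrable]
  rw [tendsto_iff_norm_sub_tendsto_zero]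
  have := hlim.rpow_const (p := 1 / p) (Or.inr (by positivity))
  rwa [Real.zero_rpow (by positivity)] at this

/-- Dilation multiplies the `n`-th Taylor term by `r ^ n`; as each term of `f` has norm at most
`‖f‖`, the series converges absolutely in norm. Point evaluations identify its sum. -/
theorem dilation_mem_closure_span_monomial (hα : 0 < α) (hm : 0 < m) {r : ℝ}
    (hr : r ∈ Set.Ioo (0 : ℝ) 1) (f : FockSpace p α m) :
    dilation hα hm hr f ∈ closure
      (Submodule.span ℂ (Set.range (monomial hα hm : ℕ → FockSpace p α m)) :
        Set (FockSpace p α m)) := by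
  have := completeSpace (p := p) hα hm
  have hsum : Summable fun n : ℕ => (iteratedDeriv n f 0 * (r : ℂ) ^ n) •
      (monomial hα hm n : FockSpace p α m) := by
    refine Summable.of_norm_bounded
      ((summable_geometric_of_lt_one hr.1.le hr.2).mul_left ‖f‖) fun n => ?_
    rw [norm_smul, norm_mul, norm_pow, Complex.norm_real, Real.norm_eq_abs, abs_of_pos hr.1,
      mul_right_comm]
    have := hr.1.le
    gcongr
    exact norm_iteratedDeriv_mul_norm_monomial_le hα hm f n
  obtain ⟨g, hg⟩ := hsum
  have hgf : g = dilation hα hm hr f := by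
    ext z
    have h1 := (eval hα hm z).hasSum hg
    refine h1.unique ?_
    rw [dilation_apply]
    convert hasSum_taylor f (r • z) using 1
    ext n
    simp only [map_smul, eval_apply, monomial_apply, smul_eq_mul,
      Complex.real_smul, mul_pow]
    ring
  rw [← hgf]
  refine mem_closure_of_tendsto hg (Eventually.of_forall fun s => ?_)
  exact Submodule.sum_mem _ fun n _ => Submodule.smul_mem _ _ (Submodule.subset_span ⟨n, rfl⟩)

theorem dense_span_monomial (hα : 0 < α) (hm : 0 < m) :
    Dense (Submodule.span ℂ (Set.range (monomial hα hm : ℕ → FockSpace p α m)) :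
      Set (FockSpace p α m)) := by
  intro f
  obtain ⟨r, -, hr, hr1⟩ := exists_seq_strictMono_tendsto' (zero_lt_one : (0 : ℝ) < 1)
  exact isClosed_closure.mem_of_tendsto (tendsto_dilation hα hm hr hr1 f)
    (Eventually.of_forall fun k => dilation_mem_closure_span_monomial hα hm (hr k) f)

end FockSpace

/-! ### Asymptotics of the monomial norms -/

/-- The growth scale `A n log n + B n + E log n`. -/
def logScale (A B E : ℝ) (n : ℕ) : ℝ := A * (n * Real.log n) + B * n + E * Real.log n

theorem logScale_neg (A B E : ℝ) (n : ℕ) : logScale (-A) (-B) (-E) n = -logScale A B E n := by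
  unfold logScale
  ring

theorem tendsto_log_div_natCast : Tendsto (fun n : ℕ => Real.log n / n) atTop (𝓝 0) := by
  have h := Real.isLittleO_log_id_atTop.tendsto_div_nhds_zero
  exact h.comp tendsto_natCast_atTop_atTop

theorem logScale_eventuallyEq (A B E : ℝ) :
    (fun n : ℕ => (n : ℝ) * (A * Real.log n + (B + E * (Real.log n / n)))) =ᶠ[atTop]
      logScale A B E := by
  filter_upwards [eventually_ge_atTop 1] with n hn
  have : (n : ℝ) ≠ 0 := by positivity
  unfold logScale
  field_simp
  ring

theorem tendsto_logScale_atTop_of_pos {A : ℝ} (hA : 0 < A) (B E : ℝ) :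
    Tendsto (logScale A B E) atTop atTop := by
  refine Tendsto.congr' (logScale_eventuallyEq A B E) ?_
  refine tendsto_natCast_atTop_atTop.atTop_mul_atTop₀ ?_
  exact ((Real.tendsto_log_atTop.comp tendsto_natCast_atTop_atTop).const_mul_atTop hA).atTop_add
    (tendsto_const_nhds.add (tendsto_log_div_natCast.const_mul E))

theorem tendsto_logScale_zero_atTop_of_pos {B : ℝ} (hB : 0 < B) (E : ℝ) :
    Tendsto (logScale 0 B E) atTop atTop := by
  refine Tendsto.congr' (logScale_eventuallyEq 0 B E) ?_
  refine tendsto_natCast_atTop_atTop.atTop_mul_pos hB ?_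
  simpa using (tendsto_log_div_natCast.const_mul E).const_add B

theorem tendsto_logScale_zero_zero_atTop_of_pos {E : ℝ} (hE : 0 < E) :
    Tendsto (logScale 0 0 E) atTop atTop := by
  have := (Real.tendsto_log_atTop.comp tendsto_natCast_atTop_atTop).const_mul_atTop hE
  refine this.congr fun n => ?_
  simp [logScale]

theorem tendsto_logScale_atBot_of_neg {A : ℝ} (hA : A < 0) (B E : ℝ) :
    Tendsto (logScale A B E) atTop atBot := by
  rw [← tendsto_neg_atTop_iff]
  exact (tendsto_logScale_atTop_of_pos (neg_pos.2 hA) (-B) (-E)).congr (logScale_neg A B E)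

theorem tendsto_logScale_zero_atBot_of_neg {B : ℝ} (hB : B < 0) (E : ℝ) :
    Tendsto (logScale 0 B E) atTop atBot := by
  rw [← tendsto_neg_atTop_iff]
  have := tendsto_logScale_zero_atTop_of_pos (neg_pos.2 hB) (-E)
  rw [← neg_zero] at this
  exact this.congr (logScale_neg 0 B E)

theorem tendsto_logScale_zero_zero_atBot_of_neg {E : ℝ} (hE : E < 0) :
    Tendsto (logScale 0 0 E) atTop atBot := by
  rw [← tendsto_neg_atTop_iff]
  have := tendsto_logScale_zero_zero_atTop_of_pos (neg_pos.2 hE)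
  rw [← neg_zero] at this
  exact this.congr (logScale_neg 0 0 E)

namespace FockSpace

variable {p α m : ℝ} [hp : Fact (1 ≤ p)]

theorem log_norm_monomial (hα : 0 < α) (hm : 0 < m) (n : ℕ) :
    Real.log ‖(monomial hα hm n : FockSpace p α m)‖ =
      1 / p * (Real.log (2 * Real.pi / m) - (n * p + 2) / m * Real.log (p * α) +
        Real.log (Real.Gamma (p / m * n + 2 / m))) - Real.log n.factorial := by
  have hp0 : 0 < p := exponent_pos
  have hpi := Real.pi_pos
  have hI := integral_fockIntegrand_pow_pos hp0 hα hm n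
  have hG := Real.Gamma_pos_of_pos (by positivity : 0 < (n * p + 2) / m)
  have hpw : 0 < (p * α) ^ (-(n * p + 2) / m) := by positivity
  rw [norm_monomial, Real.log_mul (by positivity) (by positivity), Real.log_inv,
    Real.log_rpow hI, integral_fockIntegrand_pow hp0 hα hm, Real.log_mul (by positivity) hG.ne',
    Real.log_mul (by positivity) hpw.ne', Real.log_rpow (by positivity)]
  have e : (n * p + 2) / m = p / m * n + 2 / m := by ring
  rw [neg_div, e]
  ring

/-- Stirling for `Γ(p n / m + 2 / m)`, divided by `p`, minus Stirling for `n!`; the power of `p * α`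
changes only the linear coefficient and the constant. -/
theorem exists_abs_log_norm_monomial_sub_le (hα : 0 < α) (hm : 0 < m) :
    ∃ K : ℝ, ∀ n : ℕ, |Real.log ‖(monomial hα hm n : FockSpace p α m)‖ -
      logScale (1 / m - 1) (1 + 1 / m * (Real.log (p / m) - 1 - Real.log (p * α)))
        (1 / p * (2 / m - 1 / 2) - 1 / 2) n| ≤ K := by
  have hp0 : 0 < p := exponent_pos
  have h1 := (log_Gamma_affine_isBigO (div_pos hp0 hm) (div_pos two_pos hm)).const_mul_left (1 / p)
  have h2 := log_factorial_isBigO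
  have h3 : (fun _ : ℕ => 1 / p * (Real.log (2 * Real.pi / m) - 2 / m * Real.log (p * α)))
      =O[atTop] (fun _ => (1 : ℝ)) := isBigO_const_const _ one_ne_zero _
  -- The finitely many small `n` are absorbed into `K`, so the bound holds for all `n`, including
  -- `0`.
  refine (isBigO_one_nat_atTop_iff (E'' := ℝ)).1 ?_
  refine ((h1.sub h2).add h3).congr_left fun n => ?_
  rw [log_norm_monomial, logScale]
  field_simp
  ring

/-! ### The differentiation operator -/

variable {D : FockSpace p α m →L[ℂ] FockSpace p α m}

theorem derivative_monomial_zero (hα : 0 < α) (hm : 0 < m)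
    (hD : ∀ (f : FockSpace p α m) (z : ℂ), D f z = deriv f z) : D (monomial hα hm 0) = 0 := by
  ext z
  rw [hD, zero_apply]
  have : ((monomial hα hm 0 : FockSpace p α m) : ℂ → ℂ) = fun _ => 1 := by
    ext w
    change (Nat.factorial 0 : ℂ)⁻¹ * w ^ 0 = 1
    simp
  rw [this, deriv_const]

theorem derivative_monomial_succ (hα : 0 < α) (hm : 0 < m)
    (hD : ∀ (f : FockSpace p α m) (z : ℂ), D f z = deriv f z) (n : ℕ) :
    D (monomial hα hm (n + 1)) = monomial hα hm n := by
  ext z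
  rw [hD, monomial_apply]
  have : ((monomial hα hm (n + 1) : FockSpace p α m) : ℂ → ℂ) =
      fun w => ((n + 1).factorial : ℂ)⁻¹ * w ^ (n + 1) := rfl
  rw [this, deriv_const_mul_field, deriv_pow_field, Nat.factorial_succ]
  have h1 : (n.factorial : ℂ) ≠ 0 := by exact_mod_cast n.factorial_ne_zero
  have h2 : (n : ℂ) + 1 ≠ 0 := by exact_mod_cast n.succ_ne_zero
  push_cast
  field_simp

theorem derivative_pow_apply (hD : ∀ (f : FockSpace p α m) (z : ℂ), D f z = deriv f z)
    (f : FockSpace p α m) (n : ℕ) : ∀ z, (D ^ n) f z = iteratedDeriv n f z := by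
  induction n with
  | zero => simp
  | succ n ih =>
    intro z
    have h : (((D ^ n) f : FockSpace p α m) : ℂ → ℂ) = iteratedDeriv n f := funext ih
    rw [pow_succ', mul_apply_eq_comp, hD, h, iteratedDeriv_succ]

/-- From `e 0 = D ^ n (e n)`, the norms `‖e n‖` decay at most geometrically, whereas for `m > 1` the
`n log n` coefficient is negative. -/
theorem exponent_le_one_of_derivative (hα : 0 < α) (hm : 0 < m)
    (hD : ∀ (f : FockSpace p α m) (z : ℂ), D f z = deriv f z) : m ≤ 1 := by
  by_contra! hm1
  obtain ⟨K, hK⟩ := exists_abs_log_norm_monomial_sub_le (p := p) hα hm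
  set B := 1 + 1 / m * (Real.log (p / m) - 1 - Real.log (p * α))
  set E := 1 / p * (2 / m - 1 / 2) - 1 / 2
  have hA : 1 / m - 1 < 0 := by
    rw [sub_neg, div_lt_one hm]
    exact hm1
  have : Nontrivial (FockSpace p α m) :=
    ⟨monomial hα hm 0, 0, norm_pos_iff.1 (norm_monomial_pos hα hm 0)⟩
  -- Adding 1 keeps `C` positive, so that `log C` may be taken; `n * log C` only shifts the linear
  -- coefficient of the scale.
  set C := ‖D‖ + 1
  have hC : 0 < C := by positivity
  have hlow : ∀ n : ℕ, Real.log ‖(monomial hα hm 0 : FockSpace p α m)‖ - K ≤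
      logScale (1 / m - 1) (B + Real.log C) E n := by
    intro n
    have h0 := pow_apply_of_backward_shift (derivative_monomial_succ hα hm hD) 0 n
    rw [zero_add] at h0
    have h1 : ‖(monomial hα hm 0 : FockSpace p α m)‖ ≤
        C ^ n * ‖(monomial hα hm n : FockSpace p α m)‖ := by
      rw [← h0]
      refine ((D ^ n).le_opNorm _).trans ?_
      gcongr
      refine (norm_pow_le D n).trans ?_
      gcongr
      exact le_add_of_nonneg_right zero_le_one
    have h2 := Real.log_le_log (norm_monomial_pos hα hm 0) h1
    rw [Real.log_mul (by positivity) (norm_monomial_pos hα hm n).ne', Real.log_pow] at h2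
    have h3 := (abs_le.1 (hK n)).2
    have h4 : logScale (1 / m - 1) (B + Real.log C) E n =
        logScale (1 / m - 1) B E n + n * Real.log C := by
      unfold logScale
      ring
    linarith
  obtain ⟨n, hn⟩ := ((tendsto_logScale_atBot_of_neg hA (B + Real.log C) E).eventually_lt_atBot
    (Real.log ‖(monomial hα hm 0 : FockSpace p α m)‖ - K)).exists
  exact (hlow n).not_gt hn

theorem isSupercyclic_derivative (hα : 0 < α) (hm : 0 < m)
    (hD : ∀ (f : FockSpace p α m) (z : ℂ), D f z = deriv f z) : IsSupercyclic D :=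
  have := completeSpace (p := p) hα hm
  isSupercyclic_of_backward_shift (derivative_monomial_zero hα hm hD)
    (derivative_monomial_succ hα hm hD) (dense_span_monomial hα hm)

theorem isHypercyclic_derivative_of_tendsto (hα : 0 < α) (hm : 0 < m)
    (hD : ∀ (f : FockSpace p α m) (z : ℂ), D f z = deriv f z)
    (h : Tendsto (fun n => Real.log ‖(monomial hα hm n : FockSpace p α m)‖) atTop atBot) :
    IsHypercyclic D := by
  have := completeSpace (p := p) hα hm
  refine isHypercyclic_of_backward_shift (derivative_monomial_zero hα hm hD)
    (derivative_monomial_succ hα hm hD) (dense_span_monomial hα hm) ?_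
  rw [tendsto_zero_iff_norm_tendsto_zero]
  exact (Real.tendsto_exp_atBot.comp h).congr fun n => Real.exp_log (norm_monomial_pos hα hm n)

/-- The functional is evaluation at `0`: on the orbit of `f` it takes the values `f⁽ⁿ⁾(0)`, bounded
by `‖f‖ / exp L` through the Taylor coefficient inequality. -/
theorem not_isHypercyclic_derivative_of_le (hα : 0 < α) (hm : 0 < m)
    (hD : ∀ (f : FockSpace p α m) (z : ℂ), D f z = deriv f z) {L : ℝ}
    (h : ∀ n, L ≤ Real.log ‖(monomial hα hm n : FockSpace p α m)‖) : ¬ IsHypercyclic D := by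
  refine not_isHypercyclic_of_bounded_functional (eval hα hm 0) (fun h0 => ?_)
    fun f => ⟨‖f‖ / Real.exp L, fun n => ?_⟩
  · have := DFunLike.congr_fun h0 (monomial hα hm 0 : FockSpace p α m)
    simp at this
  · rw [eval_apply, derivative_pow_apply hD, le_div_iff₀ (Real.exp_pos L)]
    refine le_trans ?_ (norm_iteratedDeriv_mul_norm_monomial_le hα hm f n)
    gcongr
    exact (Real.le_log_iff_exp_le (norm_monomial_pos hα hm n)).1 (h n)

theorem isHypercyclic_derivative_iff (hα : 0 < α) (hm : 0 < m)
    (hD : ∀ (f : FockSpace p α m) (z : ℂ), D f z = deriv f z) :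
    IsHypercyclic D ↔ (m = 1 ∧ 1 < α) ∨ (m = 1 ∧ α = 1 ∧ 3 < p) := by
  have hp0 : 0 < p := exponent_pos
  obtain ⟨K, hK⟩ := exists_abs_log_norm_monomial_sub_le (p := p) hα hm
  have hyes : Tendsto (logScale (1 / m - 1) (1 + 1 / m * (Real.log (p / m) - 1 -
      Real.log (p * α))) (1 / p * (2 / m - 1 / 2) - 1 / 2)) atTop atBot → IsHypercyclic D :=
    fun h => isHypercyclic_derivative_of_tendsto hα hm hD
      (tendsto_atBot_mono (fun n => by linarith [(abs_le.1 (hK n)).2])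
        (tendsto_atBot_add_const_right _ K h))
  have hno : BddBelow (Set.range (logScale (1 / m - 1) (1 + 1 / m * (Real.log (p / m) - 1 -
      Real.log (p * α))) (1 / p * (2 / m - 1 / 2) - 1 / 2))) → ¬ IsHypercyclic D := by
    rintro ⟨L, hL⟩
    exact not_isHypercyclic_derivative_of_le hα hm hD (L := L - K) fun n => by
      linarith [(abs_le.1 (hK n)).1, hL ⟨n, rfl⟩]
  rcases (exponent_le_one_of_derivative hα hm hD).lt_or_eq with hm1 | rfl
  · refine iff_of_false (hno ?_) ?_
    · refine bddBelow_range_of_tendsto_atTop_atTop (tendsto_logScale_atTop_of_pos ?_ _ _)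
      rw [sub_pos, lt_div_iff₀ hm]
      linarith
    · rintro (h | h) <;> linarith [h.1]
  -- For `m = 1` the scale reduces to `-n log α + (3 - p)/(2p) log n`, which explains the thresholds
  -- `α = 1` and `p = 3`.
  · have hA : (1 : ℝ) / 1 - 1 = 0 := by norm_num
    have hB : 1 + 1 / 1 * (Real.log (p / 1) - 1 - Real.log (p * α)) = -Real.log α := by
      rw [Real.log_mul hp0.ne' hα.ne', div_one, div_one]
      ring
    have hE : 1 / p * (2 / 1 - 1 / 2) - 1 / 2 = (3 - p) / (2 * p) := by
      field_simp
      ring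
    rw [hA, hB, hE] at hyes hno
    rcases lt_trichotomy α 1 with hα1 | rfl | hα1
    · refine iff_of_false (hno ?_) ?_
      · exact bddBelow_range_of_tendsto_atTop_atTop (tendsto_logScale_zero_atTop_of_pos
          (neg_pos.2 (Real.log_neg hα hα1)) _)
      · rintro (h | h)
        · linarith [h.2]
        · linarith [h.2.1]
    · rw [Real.log_one, neg_zero] at hyes hno
      rcases lt_or_ge 3 p with hp3 | hp3
      · refine iff_of_true (hyes (tendsto_logScale_zero_zero_atBot_of_neg ?_)) (by simp [hp3])
        exact div_neg_of_neg_of_pos (by linarith) (by positivity)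
      -- At `α = 1`, `p ≤ 3` the scale is nonnegative for every `n`. For `p = 3` it vanishes
      -- identically, so a lower bound is available but divergence is not.
      · refine iff_of_false (hno ⟨0, ?_⟩) (by simp [hp3])
        rintro _ ⟨n, rfl⟩
        have h1 : 0 ≤ (3 - p) / (2 * p) := div_nonneg (by linarith) (by positivity)
        have h2 : 0 ≤ Real.log n := Real.log_natCast_nonneg n
        simpa [logScale] using mul_nonneg h1 h2
    · exact iff_of_true (hyes (tendsto_logScale_zero_atBot_of_neg
        (neg_neg_iff_pos.2 (Real.log_pos hα1)) _)) (Or.inl ⟨rfl, hα1⟩)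

end FockSpace

end

theorem proposition2p1 (p α m : ℝ) [Fact (1 ≤ p)] (hα : 0 < α) (hm : 0 < m)
    (D : FockSpace p α m →L[ℂ] FockSpace p α m)
    (hD : ∀ (f : FockSpace p α m) (z : ℂ), D f z = deriv f z) :
    m ≤ 1 ∧
      (IsHypercyclic D ↔ (m = 1 ∧ 1 < α) ∨ (m = 1 ∧ α = 1 ∧ 3 < p)) ∧
      IsSupercyclic D ∧
      IsCyclicOperator D :=
  ⟨FockSpace.exponent_le_one_of_derivative hα hm hD,
    FockSpace.isHypercyclic_derivative_iff hα hm hD,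
    FockSpace.isSupercyclic_derivative hα hm hD,
    (FockSpace.isSupercyclic_derivative hα hm hD).isCyclicOperator⟩
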